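/- Let $K$ be a field with a (Krull) valuation of arbitrary rank whose valuation ring $R$ is Henselian, and let $\mathfrak{m}$ be the maximal ideal of $R$; equip $R$ with the valuation topology, $R^n$ with the product topology and subsets of $R^n$ with the subspace topology. For $c\in R$ write $c\cdot\mathfrak{m}^{\times n}=\{(cx_1,\dots,cx_n): x_1,\dots,x_n\in\mathfrak{m}\}\subseteq R^n$. Let $f=(f_1,\dots,f_n)$ be an $n$-tuple of polynomials $f_1,\dots,f_n\in R[X]$, $X=(X_1,\dots,X_n)$, and let $J=\det(\partial f_i/\partial X_j)$ be its Jacobian determinant. If $f(\mathbf{0})=\mathbf{0}$ and $e:=J(\mathbf{0})\neq 0$, then $f$ maps $e^2\cdot\mathfrak{m}^{\times n}$ into $e\cdot\mathfrak{m}^{\times n}$, and the restricted map $e^2\cdot\mathfrak{m}^{\times n}\to e\cdot\mathfrak{m}^{\times n}$ is an open embedding, i.e. a homeomorphism onto an open subset of $e\cdot\mathfrak{m}^{\times n}$. -/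

import Mathlib

/-- The polynomial map `R ^ n → R ^ n`, `x ↦ (f₁(x), …, fₙ(x))`. -/
noncomputable def polyMap {R : Type*} [CommRing R] {n : ℕ}
    (f : Fin n → MvPolynomial (Fin n) R) (x : Fin n → R) : Fin n → R :=
  fun i => MvPolynomial.eval x (f i)

/-- The Jacobian determinant `det (∂ fᵢ / ∂ Xⱼ)`, as a polynomial. -/
noncomputable def jacobianDet {R : Type*} [CommRing R] {n : ℕ}
    (f : Fin n → MvPolynomial (Fin n) R) : MvPolynomial (Fin n) R :=
  (Matrix.of fun i j => MvPolynomial.pderiv j (f i)).det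

/-- The set `c · 𝔪ⁿ = {(c x₁, …, c xₙ) : x₁, …, xₙ ∈ 𝔪}` in `R ^ n`, where `𝔪` is the maximal
ideal of the local ring `R` and `𝔪ⁿ` is the `n`-fold Cartesian product of `𝔪`. -/
def scaledBox {R : Type*} [CommRing R] [IsLocalRing R] (n : ℕ) (c : R) : Set (Fin n → R) :=
  (fun x : Fin n → R => c • x) '' {x | ∀ i, x i ∈ IsLocalRing.maximalIdeal R}

/-! Let `A` be the Jacobian matrix at the origin, `e = det A`. Taylor expansion gives `f (e² x) = e²
A x + e⁴ q x` with `q` free of constant and linear terms. As `adj A * A = e`, applying `adj A`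
yields `e³ g x`, where `g x = x + e (adj A) (q x)` is tangent to the identity. Since `e ≠ 0`, `adj
A` and `e³` cancel, so everything reduces to `g` on `𝔪ⁿ`.

There `g` is onto by the multivariate Hensel lemma (`exists_polyMap_eq`), and by Nakayama the
differences `x i - y i` lie in any ideal containing all `g x i - g y i`
(`sub_mem_of_polyMap_sub_mem`). The zero ideal gives injectivity, the ideals `c 𝔪` give openness.
The Hensel lemma itself reduces to one variable because étale algebras are locally standard étale.
-/

/-! ### Étale algebras and the multivariate Hensel lemma -/

open IsLocalRing in
/-- Over a Henselian local ring, every rational point of the special fibre of an étale algebra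
lifts to a section. -/
theorem HenselianLocalRing.exists_algHom_lift {R S : Type*} [CommRing R] [HenselianLocalRing R]
    [CommRing S] [Algebra R S] [Algebra.Etale R S] (φ : S →ₐ[R] ResidueField R) :
    ∃ ψ : S →ₐ[R] R, ∀ s, residue R (ψ s) = φ s := by
  have : Algebra.FinitePresentation R S := Algebra.Etale.finitePresentation
  have hQ : (RingHom.ker φ).IsPrime := RingHom.ker_isPrime φ
  have : Algebra.IsEtaleAt R (RingHom.ker φ) :=
    have : Algebra.FormallyEtale S (Localization.AtPrime (RingHom.ker φ)) :=
      .of_isLocalization (RingHom.ker φ).primeCompl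
    Algebra.FormallyEtale.comp R S _
  obtain ⟨g, hg, hS⟩ := Algebra.IsEtaleAt.exists_isStandardEtale (R := R) (RingHom.ker φ)
  let P : StandardEtalePresentation R (Localization.Away g) := hS.1.some
  let φ' : Localization.Away g →ₐ[R] ResidueField R :=
    IsLocalization.Away.liftAlgHom (f := φ) g (by simpa [RingHom.mem_ker] using hg)
  have hφ' : ∀ s, φ' (algebraMap S _ s) = φ s := fun s => by simp [φ']
  have hx := P.hasMap.map φ'
  obtain ⟨a₀, ha₀⟩ := residue_surjective (φ' P.x)
  have key (p : Polynomial R) (a : R) : Polynomial.aeval (residue R a) p = residue R (p.eval a) := by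
    rw [← ResidueField.algebraMap_eq, Polynomial.aeval_algebraMap_apply_eq_algebraMap_eval]
  -- A standard étale algebra has one generator, so its section is a root of one monic polynomial,
  -- simple modulo `𝔪`.
  obtain ⟨a, ha, haa⟩ := HenselianLocalRing.is_henselian P.P.f P.P.monic_f a₀
    (by rw [← residue_eq_zero_iff, ← key, ha₀, hx.1])
    (by
      have := hx.isUnit_derivative_f
      rw [← ha₀, key] at this
      exact isUnit_of_map_unit (residue R) _ this)
  have hres : residue R a = φ' P.x := by
    rw [← ha₀, ← sub_eq_zero, ← map_sub, residue_eq_zero_iff]; exact haa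
  have hmap : P.P.HasMap a := by
    refine ⟨by simpa using ha, ?_⟩
    have := hx.2
    rw [← hres, key] at this
    simpa using isUnit_of_map_unit (residue R) _ this
  let ψ : Localization.Away g →ₐ[R] R := (P.P.lift a hmap).comp P.equivRing.toAlgHom
  have hψ : (Algebra.ofId R (ResidueField R)).comp ψ = φ' := by
    apply P.hom_ext
    simpa [ψ, Algebra.ofId_apply] using hres
  refine ⟨ψ.comp (IsScalarTower.toAlgHom R S _), fun s => ?_⟩
  simpa [Algebra.ofId_apply, hφ'] using congr($hψ (algebraMap S _ s))

-- There are as many relations as variables, and inverting the Jacobian makes the presentation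
-- submersive of relative dimension zero.
open MvPolynomial in
theorem isEtale_away_jacobianDet {R : Type*} [CommRing R] {n : ℕ}
    (f : Fin n → MvPolynomial (Fin n) R) :
    Algebra.Etale R (Localization.Away
      (Ideal.Quotient.mk (Ideal.span (Set.range f)) (jacobianDet f))) := by
  let S := MvPolynomial (Fin n) R ⧸ Ideal.span (Set.range f)
  let P : Algebra.PreSubmersivePresentation R S (Fin n) (Fin n) :=
    .naive (v := f) id Function.injective_id
  let T := Localization.Away (Ideal.Quotient.mk (Ideal.span (Set.range f)) (jacobianDet f))
  let Q := Algebra.PreSubmersivePresentation.localizationAway T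
      (Ideal.Quotient.mk (Ideal.span (Set.range f)) (jacobianDet f))
  have hP : P.jacobian = Ideal.Quotient.mk (Ideal.span (Set.range f)) (jacobianDet f) := by
    have hM : P.jacobiMatrix = (Matrix.of fun i j => pderiv j (f i)).transpose := by
      ext1 i j
      exact P.jacobiMatrix_apply i j
    rw [P.jacobian_eq_jacobiMatrix_det, jacobianDet, hM, Matrix.det_transpose]
    rfl
  let W : Algebra.SubmersivePresentation R T (Unit ⊕ Fin n) (Unit ⊕ Fin n) :=
    { Q.comp P with
      jacobian_isUnit := by
        change IsUnit (Q.comp P).jacobian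
        rw [Algebra.PreSubmersivePresentation.comp_jacobian_eq_jacobian_smul_jacobian, hP,
          Algebra.PreSubmersivePresentation.localizationAway_jacobian, Algebra.smul_def]
        exact (IsLocalization.Away.algebraMap_isUnit _).mul
          (IsLocalization.Away.algebraMap_isUnit _) }
  have : Algebra.IsStandardSmoothOfRelativeDimension 0 R T :=
    W.isStandardSmoothOfRelativeDimension (by simp [Algebra.Presentation.dimension])
  exact inferInstanceAs (Algebra.Etale R T)

open IsLocalRing in
/-- The multivariate Hensel lemma, for an approximate zero at the origin. -/
theorem HenselianLocalRing.exists_polyMap_eq_zero {R : Type*} [CommRing R] [HenselianLocalRing R]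
    {n : ℕ} (f : Fin n → MvPolynomial (Fin n) R) (hf : ∀ i, polyMap f 0 i ∈ maximalIdeal R)
    (hJ : IsUnit (MvPolynomial.eval 0 (jacobianDet f))) :
    ∃ x : Fin n → R, (∀ i, x i ∈ maximalIdeal R) ∧ polyMap f x = 0 := by
  have := isEtale_away_jacobianDet f
  have hev (p : MvPolynomial (Fin n) R) :
      MvPolynomial.aeval (0 : Fin n → ResidueField R) p = residue R (MvPolynomial.eval 0 p) := by
    simp
  let φ₀ : (MvPolynomial (Fin n) R ⧸ Ideal.span (Set.range f)) →ₐ[R] ResidueField R :=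
    Ideal.Quotient.liftₐ _ (MvPolynomial.aeval 0) fun a ha => by
      have hle : Ideal.span (Set.range f) ≤
          RingHom.ker (MvPolynomial.aeval (R := R) (0 : Fin n → ResidueField R)) := by
        rw [Ideal.span_le]
        rintro _ ⟨i, rfl⟩
        simp only [SetLike.mem_coe, RingHom.mem_ker, hev, residue_eq_zero_iff]
        exact hf i
      exact hle ha
  have hφ₀ (p : MvPolynomial (Fin n) R) :
      φ₀ (Ideal.Quotient.mk _ p) = MvPolynomial.aeval 0 p := rfl
  obtain ⟨ψ, hψ⟩ := HenselianLocalRing.exists_algHom_lift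
    (IsLocalization.Away.liftAlgHom (f := φ₀)
      (Ideal.Quotient.mk (Ideal.span (Set.range f)) (jacobianDet f))
      (S := Localization.Away (Ideal.Quotient.mk (Ideal.span (Set.range f)) (jacobianDet f)))
      (by rw [hφ₀, hev]; exact hJ.map _))
  let θ : MvPolynomial (Fin n) R →ₐ[R] R :=
    (ψ.comp (IsScalarTower.toAlgHom R (MvPolynomial (Fin n) R ⧸ Ideal.span (Set.range f)) _)).comp
      (Ideal.Quotient.mkₐ R _)
  refine ⟨fun i => θ (.X i), fun i => ?_, funext fun i => ?_⟩
  · rw [← residue_eq_zero_iff]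
    simp [θ, hψ, hφ₀]
  · have h : θ (f i) = 0 := by
      have : Ideal.Quotient.mk (Ideal.span (Set.range f)) (f i) = 0 :=
        Ideal.Quotient.eq_zero_iff_mem.2 (Ideal.subset_span ⟨i, rfl⟩)
      simp [θ, this]
    rw [MvPolynomial.aeval_unique θ] at h
    rwa [MvPolynomial.aeval_eq_eval] at h

/-! ### Taylor estimates -/

open IsLocalRing MvPolynomial in
/-- First-order Taylor estimate at the origin of a local ring. -/
theorem MvPolynomial.eval_sub_eval_sub_sum_mem {R ι : Type*} [CommRing R] [IsLocalRing R]
    [Fintype ι] (p : MvPolynomial ι R) {x y : ι → R} {I : Ideal R}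
    (hx : ∀ i, x i ∈ maximalIdeal R) (hy : ∀ i, y i ∈ maximalIdeal R)
    (hI : ∀ i, x i - y i ∈ I) :
    eval x p - eval y p - ∑ j, eval 0 (pderiv j p) * (x j - y j) ∈ maximalIdeal R * I := by
  classical
  have hI' (p : MvPolynomial ι R) : eval x p - eval y p ∈ I := by
    induction p using MvPolynomial.induction_on with
    | C a => simp
    | add p q hp hq =>
      rw [map_add, map_add, add_sub_add_comm]
      exact add_mem hp hq
    | mul_X p i hp =>
      have : eval x (p * X i) - eval y (p * X i) =
          (x i - y i) * eval x p + (eval x p - eval y p) * y i := by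
        simp only [map_mul, eval_X]; ring
      rw [this]
      exact add_mem (I.mul_mem_right _ (hI i)) (I.mul_mem_right _ hp)
  have hm (p : MvPolynomial ι R) : eval x p - eval 0 p ∈ maximalIdeal R := by
    induction p using MvPolynomial.induction_on with
    | C a => simp
    | add p q hp hq =>
      rw [map_add, map_add, add_sub_add_comm]
      exact add_mem hp hq
    | mul_X p i hp => simpa using Ideal.mul_mem_left _ _ (hx i)
  induction p using MvPolynomial.induction_on with
  | C a => simp
  | add p q hp hq =>
    convert add_mem hp hq using 1
    simp only [map_add, add_mul, Finset.sum_add_distrib]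
    ring
  | mul_X p i hp =>
    have hs : ∑ j, eval 0 (pderiv j (p * X i)) * (x j - y j) = eval 0 p * (x i - y i) := by
      rw [Finset.sum_eq_single i]
      · simp
      · intro j _ hj
        simp [pderiv_X_of_ne hj.symm]
      · simp
    have : eval x (p * X i) - eval y (p * X i) - eval 0 p * (x i - y i) =
        (eval x p - eval 0 p) * (x i - y i) + y i * (eval x p - eval y p) := by
      simp only [map_mul, eval_X]; ring
    rw [hs, this]
    exact add_mem (Ideal.mul_mem_mul (hm p) (hI i)) (Ideal.mul_mem_mul (hy i) (hI' p))

open MvPolynomial in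
/-- Second-order Taylor expansion of `p (c x)` in the scalar `c`. -/
theorem MvPolynomial.exists_eval_smul_eq {R ι : Type*} [CommRing R] [Fintype ι]
    (p : MvPolynomial ι R) (c : R) :
    ∃ q : MvPolynomial ι R, eval 0 q = 0 ∧ (∀ j, eval 0 (pderiv j q) = 0) ∧
      ∀ x, eval (c • x) p =
        eval 0 p + c * ∑ j, eval 0 (pderiv j p) * x j + c ^ 2 * eval x q := by
  classical
  induction p using MvPolynomial.induction_on with
  | C a => exact ⟨0, by simp, by simp, by simp⟩
  | add p q hp hq =>
    obtain ⟨p', hp₀, hp₁, hp⟩ := hp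
    obtain ⟨q', hq₀, hq₁, hq⟩ := hq
    refine ⟨p' + q', by rw [map_add, hp₀, hq₀, add_zero],
      fun j => by rw [map_add, map_add, hp₁, hq₁, add_zero], fun x => ?_⟩
    simp only [map_add, hp, hq, add_mul, Finset.sum_add_distrib]
    ring
  | mul_X p i hp =>
    obtain ⟨q, hq₀, hq₁, hq⟩ := hp
    -- Multiply the expansion of `p (c x)` by `c * x i` and collect the terms divisible by `c ^ 2`.
    refine ⟨X i * ((∑ j, C (eval 0 (pderiv j p)) * X j) + C c * q), by simp, fun j => ?_,
      fun x => ?_⟩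
    · simp only [Derivation.leibniz, smul_eq_mul, map_add, map_mul, map_sum, eval_X, eval_C, hq₀,
        Pi.zero_apply, mul_zero, Finset.sum_const_zero, zero_mul, add_zero]
    · have hs : ∑ j, eval 0 (pderiv j (p * X i)) * x j = eval 0 p * x i := by
        rw [Finset.sum_eq_single i]
        · simp
        · intro j _ hj
          simp [pderiv_X_of_ne hj.symm]
        · simp
      rw [hs]
      simp only [map_mul, eval_X, hq, map_add, map_sum, eval_C, Pi.smul_apply, smul_eq_mul,
        Pi.zero_apply, mul_zero]
      ring

/-! ### Maps tangent to the identity -/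

open IsLocalRing MvPolynomial in
/-- A polynomial map tangent to the identity at the origin of a Henselian local ring maps the
maximal box onto itself. -/
theorem HenselianLocalRing.exists_polyMap_eq {R : Type*} [CommRing R] [HenselianLocalRing R]
    {n : ℕ} (g : Fin n → MvPolynomial (Fin n) R) (hg₀ : polyMap g 0 = 0)
    (hg₁ : ∀ i j, eval 0 (pderiv j (g i)) = if i = j then 1 else 0)
    {w : Fin n → R} (hw : ∀ i, w i ∈ maximalIdeal R) :
    ∃ x : Fin n → R, (∀ i, x i ∈ maximalIdeal R) ∧ polyMap g x = w := by
  obtain ⟨x, hx, h⟩ := HenselianLocalRing.exists_polyMap_eq_zero (fun i => g i - C (w i))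
    (fun i => by
      have : eval 0 (g i) = 0 := congr_fun hg₀ i
      simpa only [polyMap, map_sub, this, eval_C, zero_sub, neg_mem_iff] using hw i)
    (by
      have : ((Matrix.of fun i j => pderiv j (g i - C (w i))).map (eval (0 : Fin n → R))) = 1 := by
        ext i j
        simp only [Matrix.map_apply, Matrix.of_apply, map_sub, pderiv_C, sub_zero, hg₁,
          Matrix.one_apply]
      rw [jacobianDet, RingHom.map_det, RingHom.mapMatrix_apply, this, Matrix.det_one]
      exact isUnit_one)
  refine ⟨x, hx, funext fun i => ?_⟩
  simpa [polyMap, sub_eq_zero] using congr_fun h i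

open IsLocalRing MvPolynomial in
/-- A polynomial map tangent to the identity at the origin of a local ring does not bring
points of the maximal box closer together. -/
theorem sub_mem_of_polyMap_sub_mem {R : Type*} [CommRing R] [IsLocalRing R]
    {n : ℕ} (g : Fin n → MvPolynomial (Fin n) R)
    (hg₁ : ∀ i j, eval 0 (pderiv j (g i)) = if i = j then 1 else 0)
    {x y : Fin n → R} (hx : ∀ i, x i ∈ maximalIdeal R) (hy : ∀ i, y i ∈ maximalIdeal R)
    {J : Ideal R} (h : ∀ i, polyMap g x i - polyMap g y i ∈ J) (i : Fin n) : x i - y i ∈ J := by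
  set I : Ideal R := Ideal.span (Set.range fun i => x i - y i) with hI
  have hmem (i : Fin n) : x i - y i ∈ I := Ideal.subset_span ⟨i, rfl⟩
  suffices I ≤ J from this (hmem i)
  -- Nakayama: the Taylor estimate gives `I ≤ J + 𝔪 I`, and `I` is finitely generated.
  refine Submodule.le_of_le_smul_of_le_jacobson_bot (I := maximalIdeal R)
    (Submodule.fg_span (Set.finite_range _)) (maximalIdeal_le_jacobson _) ?_
  rw [hI, Ideal.span_le]
  rintro _ ⟨i, rfl⟩
  have ht := (g i).eval_sub_eval_sub_sum_mem hx hy hmem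
  simp only [hg₁, ite_mul, one_mul, zero_mul, Finset.sum_ite_eq, Finset.mem_univ, if_true] at ht
  have := sub_mem (Submodule.mem_sup_left (T := maximalIdeal R • I) (h i))
    (Submodule.mem_sup_right (S := J) ht)
  simpa [polyMap] using this

/-! ### The valuation topology through ideals -/

-- The coset `a + c 𝔪` is the open ball of radius `v c` around `a`.
open Topology in
theorem Valued.integer.mem_nhds_iff {K Γ₀ : Type*} [Field K] [LinearOrderedCommGroupWithZero Γ₀]
    [Valued K Γ₀] [IsLocalRing (Valued.integer K)] {a : Valued.integer K}
    {s : Set (Valued.integer K)} :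
    s ∈ 𝓝 a ↔ ∃ c : Valued.integer K, c ≠ 0 ∧
      ∀ y, y - a ∈ Ideal.span {c} * IsLocalRing.maximalIdeal (Valued.integer K) → y ∈ s := by
  have hv (c : Valued.integer K) (hc : c ≠ 0) (z : Valued.integer K) :
      z ∈ Ideal.span {c} * IsLocalRing.maximalIdeal (Valued.integer K) ↔
        Valued.v (z : K) < Valued.v (c : K) := by
    have hc' : Valued.v (c : K) ≠ 0 := by simpa using hc
    rw [Ideal.mem_span_singleton_mul]
    constructor
    · rintro ⟨m, hm, rfl⟩
      have : Valued.v (m : K) < 1 := Valuation.Integer.not_isUnit_iff_valuation_lt_one.1 hm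
      simpa using mul_lt_mul_of_pos_left this (zero_lt_iff.2 hc')
    · intro h
      obtain ⟨m, rfl⟩ := (Valuation.integer.integers (Valued.v (R := K))).dvd_of_le
        (x := z) (y := c) h.le
      refine ⟨m, (IsLocalRing.mem_maximalIdeal _).2 (Valuation.Integer.not_isUnit_iff_valuation_lt_one.2 ?_), rfl⟩
      have h' : Valued.v (c : K) * Valued.v (m : K) < Valued.v (c : K) := by simpa using h
      exact (mul_lt_iff_lt_one_right (zero_lt_iff.2 hc')).1 h'
  rw [nhds_subtype, Filter.mem_comap]
  constructor
  · rintro ⟨t, ht, hts⟩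
    obtain ⟨γ, hγ⟩ := Valued.mem_nhds.1 ht
    obtain ⟨r, hr⟩ := MonoidWithZeroHom.ValueGroup₀.restrict₀_surjective _ γ.1
    have hr' : Valued.v.restrict r = γ.1 := hr
    have hr0 : r ≠ 0 := by
      rintro rfl
      exact γ.ne_zero (by rw [← hr', map_zero])
    -- The radius may be attained only outside the valuation ring; it then exceeds `1`, and `c = 1`
    -- serves.
    obtain ⟨c, hc, hcr⟩ : ∃ c : Valued.integer K, c ≠ 0 ∧ Valued.v (c : K) ≤ Valued.v r := by
      rcases le_total (Valued.v r) 1 with h | h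
      · exact ⟨⟨r, h⟩, by simpa [Subtype.ext_iff] using hr0, le_rfl⟩
      · exact ⟨1, one_ne_zero, by simpa using h⟩
    refine ⟨c, hc, fun y hy => hts (hγ ?_)⟩
    change Valued.v.restrict ((y : K) - a) < γ.1
    rw [← hr', Valuation.restrict_lt_iff]
    exact ((hv c hc _).1 hy).trans_le hcr
  · rintro ⟨c, hc, h⟩
    refine ⟨{z | Valued.v (z - (a : K)) < Valued.v (c : K)}, Valued.mem_nhds.2
      ⟨Units.mk0 (Valued.v.restrict (c : K)) (by simpa using hc), fun z hz => ?_⟩,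
      fun y hy => h y ((hv c hc _).2 hy)⟩
    exact Valuation.restrict_lt_iff _ |>.1 hz

open Topology in
theorem Valued.integer.mem_nhds_pi_iff {K Γ₀ ι : Type*} [Field K]
    [LinearOrderedCommGroupWithZero Γ₀] [Valued K Γ₀] [IsLocalRing (Valued.integer K)] [Fintype ι]
    {a : ι → Valued.integer K} {s : Set (ι → Valued.integer K)} :
    s ∈ 𝓝 a ↔ ∃ c : Valued.integer K, c ≠ 0 ∧
      ∀ y, (∀ i, y i - a i ∈ Ideal.span {c} * IsLocalRing.maximalIdeal (Valued.integer K)) → y ∈ s := by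
  rw [nhds_pi, Filter.mem_pi']
  constructor
  · rintro ⟨I, t, ht, hts⟩
    choose c hc h using fun i => mem_nhds_iff.1 (ht i)
    refine ⟨∏ i, c i, Finset.prod_ne_zero_iff.2 fun i _ => hc i, fun y hy => hts fun i _ => ?_⟩
    refine h i _ (Ideal.mul_mono_left ?_ (hy i))
    exact Ideal.span_singleton_le_span_singleton.2 (Finset.dvd_prod_of_mem c (Finset.mem_univ i))
  · rintro ⟨c, hc, h⟩
    exact ⟨Finset.univ, fun i => {z | z - a i ∈ Ideal.span {c} *
      IsLocalRing.maximalIdeal (Valued.integer K)},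
      fun i => mem_nhds_iff.2 ⟨c, hc, fun y hy => hy⟩, fun y hy => h y fun i => hy i (by simp)⟩

/-! ### Rescaling and the open embedding -/

open MvPolynomial Matrix in
/-- After the rescaling `x ↦ e² x`, where `e` is the Jacobian determinant at the origin, the
adjugate of the Jacobian matrix turns `f` into `e³` times a map tangent to the identity. -/
theorem exists_adjugate_mulVec_polyMap_eq {R : Type*} [CommRing R] {n : ℕ}
    (f : Fin n → MvPolynomial (Fin n) R) (hf : polyMap f 0 = 0)
    (A : Matrix (Fin n) (Fin n) R) (hA : A = of fun i j => eval 0 (pderiv j (f i))) :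
    ∃ g : Fin n → MvPolynomial (Fin n) R, polyMap g 0 = 0 ∧
      (∀ i j, eval 0 (pderiv j (g i)) = if i = j then 1 else 0) ∧
      ∀ x, A.adjugate *ᵥ polyMap f (A.det ^ 2 • x) = A.det ^ 3 • polyMap g x := by
  choose q hq₀ hq₁ hq using fun i => (f i).exists_eval_smul_eq (A.det ^ 2)
  refine ⟨fun i => X i + C A.det * ∑ k, C (A.adjugate i k) * q k, funext fun i => ?_,
    fun i j => ?_, fun x => ?_⟩
  · simp only [polyMap, map_add, map_mul, map_sum, eval_X, eval_C, hq₀, Pi.zero_apply, mul_zero,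
      Finset.sum_const_zero, add_zero]
  · simp only [map_add, map_sum, Derivation.leibniz, pderiv_C, pderiv_X, smul_eq_mul, mul_zero,
      add_zero, map_mul, eval_C, hq₁, Finset.sum_const_zero]
    by_cases h : i = j
    · subst h; simp
    · simp [h]
  · have hfx : polyMap f (A.det ^ 2 • x) =
        A.det ^ 2 • A *ᵥ x + A.det ^ 4 • fun i => eval x (q i) := by
      ext i
      have hi : eval 0 (f i) = 0 := congr_fun hf i
      have hAi (j) : A i j = eval 0 (pderiv j (f i)) := by rw [hA, of_apply]
      simp only [polyMap, hq, hi, hAi, Pi.add_apply, Pi.smul_apply, smul_eq_mul, mulVec, dotProduct]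
      ring
    rw [hfx, mulVec_add, mulVec_smul, mulVec_smul, mulVec_mulVec, adjugate_mul, smul_mulVec,
      one_mulVec]
    ext i
    simp only [polyMap, map_add, map_mul, map_sum, eval_X, eval_C, Pi.add_apply, Pi.smul_apply,
      smul_eq_mul, mulVec, dotProduct]
    ring

open MvPolynomial IsLocalRing in
theorem mapsTo_polyMap_scaledBox_sq {R : Type*} [CommRing R] [IsLocalRing R] {n : ℕ}
    (f : Fin n → MvPolynomial (Fin n) R) (hf : polyMap f 0 = 0) (c : R) :
    Set.MapsTo (polyMap f) (scaledBox n (c ^ 2)) (scaledBox n c) := by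
  rintro _ ⟨x, hx, rfl⟩
  choose q hq₀ hq₁ hq using fun i => (f i).exists_eval_smul_eq (c ^ 2)
  refine ⟨fun i => c * (∑ j, eval 0 (pderiv j (f i)) * x j + c ^ 2 * eval x (q i)), fun i => ?_,
    funext fun i => ?_⟩
  -- Comparison with the origin, where `q i` vanishes to second order, puts its value at `x` in `𝔪 *
  -- 𝔪`.
  · have hqx := (q i).eval_sub_eval_sub_sum_mem hx (y := 0) (fun i => zero_mem _)
      (fun i => by simpa only [Pi.zero_apply, sub_zero] using hx i)
    simp only [hq₀, hq₁, zero_mul, Finset.sum_const_zero, sub_zero] at hqx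
    exact Ideal.mul_mem_left _ _ (add_mem (Ideal.sum_mem _ fun j _ => Ideal.mul_mem_left _ _ (hx j))
      (Ideal.mul_mem_left _ _ (Ideal.mul_le_left hqx)))
  · have hi : eval 0 (f i) = 0 := congr_fun hf i
    simp only [polyMap, hq, hi, Pi.smul_apply, smul_eq_mul]
    ring

open Matrix in
theorem Matrix.eq_of_adjugate_mulVec_eq {R ι : Type*} [CommRing R] [IsDomain R] [Fintype ι]
    [DecidableEq ι] {A : Matrix ι ι R} (hA : A.det ≠ 0) {z w : ι → R}
    (h : A.adjugate *ᵥ z = A.adjugate *ᵥ w) : z = w := by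
  have h' := congrArg (A *ᵥ ·) h
  simp only [mulVec_mulVec, mul_adjugate, smul_mulVec, one_mulVec] at h'
  exact smul_right_injective _ hA h'

open Topology Matrix in
/-- The polynomial map `f` is open on the box `e² · 𝔪ⁿ`, where `e` is the Jacobian determinant. -/
theorem image_polyMap_inter_scaledBox_mem_nhds {K Γ₀ : Type*} [Field K]
    [LinearOrderedCommGroupWithZero Γ₀] [Valued K Γ₀] [HenselianLocalRing (Valued.integer K)]
    {n : ℕ} (f : Fin n → MvPolynomial (Fin n) (Valued.integer K)) (hf : polyMap f 0 = 0)
    (A : Matrix (Fin n) (Fin n) (Valued.integer K))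
    (hA : A = of fun i j => MvPolynomial.eval 0 (MvPolynomial.pderiv j (f i))) (hA0 : A.det ≠ 0)
    {p : Fin n → Valued.integer K} (hp : p ∈ scaledBox n (A.det ^ 2))
    {s : Set (Fin n → Valued.integer K)} (hs : s ∈ 𝓝 p) :
    polyMap f '' (s ∩ scaledBox n (A.det ^ 2)) ∈ 𝓝 (polyMap f p) := by
  obtain ⟨x, hx, rfl⟩ := hp
  beta_reduce at hs ⊢
  replace hx (i) : x i ∈ IsLocalRing.maximalIdeal (Valued.integer K) := hx i
  obtain ⟨g, hg₀, hg₁, hg⟩ := exists_adjugate_mulVec_polyMap_eq f hf A hA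
  obtain ⟨c, hc, hcs⟩ := Valued.integer.mem_nhds_pi_iff.1 hs
  have hcont : Continuous fun z => A.adjugate *ᵥ (z - polyMap f (A.det ^ 2 • x)) :=
    continuous_const.matrix_mulVec (continuous_id.sub continuous_const)
  -- The neighbourhood consists of the `z` for which `adj A` sends `z - f (e² x)` into `e³ c 𝔪ⁿ`;
  -- dividing by `e³` leaves a perturbation of `g x` by `c 𝔪ⁿ`.
  refine Filter.mem_of_superset (hcont.continuousAt.preimage_mem_nhds
    (Valued.integer.mem_nhds_pi_iff.2 ⟨A.det ^ 3 * c, mul_ne_zero (pow_ne_zero _ hA0) hc,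
      fun y hy => hy⟩)) fun z hz => ?_
  have ht (i) : ∃ t ∈ IsLocalRing.maximalIdeal (Valued.integer K), A.det ^ 3 * c * t =
      (A.adjugate *ᵥ (z - polyMap f (A.det ^ 2 • x))) i := by
    have := hz i
    rwa [sub_self, mulVec_zero, Pi.zero_apply, sub_zero, Ideal.mem_span_singleton_mul] at this
  choose t htm ht using ht
  have hgx (i) : polyMap g x i ∈ IsLocalRing.maximalIdeal (Valued.integer K) := by
    -- With scaling factor `1` this says that `g` preserves `𝔪ⁿ`.
    obtain ⟨w, hw, hwg⟩ := mapsTo_polyMap_scaledBox_sq g hg₀ 1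
      (⟨x, hx, by simp⟩ : x ∈ scaledBox n (1 ^ 2))
    rw [← hwg]
    simpa using hw i
  obtain ⟨y, hy, hgy⟩ := HenselianLocalRing.exists_polyMap_eq g hg₀ hg₁
    (w := polyMap g x + c • t) fun i => add_mem (hgx i) (Ideal.mul_mem_left _ _ (htm i))
  have hxy := sub_mem_of_polyMap_sub_mem g hg₁ hy hx
    (J := Ideal.span {c} * IsLocalRing.maximalIdeal (Valued.integer K)) fun i => by
      rw [hgy, Pi.add_apply, add_sub_cancel_left]
      exact Ideal.mul_mem_mul (Ideal.mem_span_singleton_self c) (htm i)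
  refine ⟨A.det ^ 2 • y, ⟨hcs _ fun i => ?_, ⟨y, hy, rfl⟩⟩, eq_of_adjugate_mulVec_eq hA0 ?_⟩
  · rw [Pi.smul_apply, Pi.smul_apply, ← smul_sub]
    exact Ideal.mul_mem_left _ _ (hxy i)
  · have ht' : A.adjugate *ᵥ (z - polyMap f (A.det ^ 2 • x)) = (A.det ^ 3 * c) • t :=
      funext fun i => (ht i).symm
    rw [mulVec_sub, hg, sub_eq_iff_eq_add] at ht'
    rw [hg, hgy, ht', smul_add, smul_smul, add_comm]

theorem injOn_polyMap_scaledBox_sq {R : Type*} [CommRing R] [IsDomain R] [IsLocalRing R] {n : ℕ}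
    (f : Fin n → MvPolynomial (Fin n) R) (hf : polyMap f 0 = 0)
    (A : Matrix (Fin n) (Fin n) R)
    (hA : A = Matrix.of fun i j => MvPolynomial.eval 0 (MvPolynomial.pderiv j (f i)))
    (hA0 : A.det ≠ 0) : Set.InjOn (polyMap f) (scaledBox n (A.det ^ 2)) := by
  rintro _ ⟨x, hx, rfl⟩ _ ⟨y, hy, rfl⟩ hxy
  obtain ⟨g, -, hg₁, hg⟩ := exists_adjugate_mulVec_polyMap_eq f hf A hA
  have hgxy : polyMap g x = polyMap g y := by
    apply smul_right_injective _ (pow_ne_zero 3 hA0)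
    simp only [← hg]
    exact congrArg _ hxy
  have : x = y := funext fun i => sub_eq_zero.1 <| (Ideal.mem_bot (R := R)).1 <|
    sub_mem_of_polyMap_sub_mem g hg₁ hx hy (fun i => by simp [hgxy]) i
  rw [this]

theorem mainTheorem3 {K Γ₀ : Type*} [Field K] [LinearOrderedCommGroupWithZero Γ₀]
    [Valued K Γ₀] [HenselianLocalRing (Valued.integer K)]
    (n : ℕ) (f : Fin n → MvPolynomial (Fin n) (Valued.integer K))
    (hf : polyMap f 0 = 0)
    (e : Valued.integer K) (he : e = MvPolynomial.eval 0 (jacobianDet f)) (he0 : e ≠ 0) :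
    ∃ h : Set.MapsTo (polyMap f) (scaledBox n (e ^ 2)) (scaledBox n e),
      Topology.IsOpenEmbedding h.restrict := by
  obtain ⟨A, hA⟩ : ∃ A, A = Matrix.of fun i j =>
      MvPolynomial.eval 0 (MvPolynomial.pderiv j (f i)) := ⟨_, rfl⟩
  have hdet : e = A.det := by
    rw [he, jacobianDet, RingHom.map_det, hA]
    rfl
  subst hdet
  have hmaps := mapsTo_polyMap_scaledBox_sq f hf A.det
  have hcont : Continuous (polyMap f) := continuous_pi fun i => MvPolynomial.continuous_eval (f i)
  refine ⟨hmaps, .of_continuous_injective_isOpenMap (hcont.restrict hmaps)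
    ((Set.MapsTo.restrict_inj hmaps).2 (injOn_polyMap_scaledBox_sq f hf A hA he0)) ?_⟩
  refine IsOpenMap.of_nhds_le fun p s hs => ?_
  rw [Filter.mem_map, nhds_subtype, Filter.mem_comap] at hs
  obtain ⟨t, ht, hts⟩ := hs
  rw [nhds_subtype, Filter.mem_comap]
  refine ⟨_, image_polyMap_inter_scaledBox_mem_nhds f hf A hA he0 p.2 ht, ?_⟩
  rintro z ⟨y, ⟨hyt, hy⟩, hyz⟩
  have hz : z = hmaps.restrict _ _ _ ⟨y, hy⟩ := Subtype.ext hyz.symm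
  rw [hz]
  exact hts (show (⟨y, hy⟩ : scaledBox n (A.det ^ 2)) ∈ Subtype.val ⁻¹' t from hyt)
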